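/- Let $\mathbb H=\{z\in\mathbb C:\operatorname{Im} z>0\}$. For a function $g$ on $\mathbb H$, $\angle\lim_{z\to\infty}g(z)=\ell$ means that for every $M>0$, $g(z)\to\ell$ as $|z|\to\infty$ within the sector $\{z\in\mathbb H:|\operatorname{Re}z|\le M\operatorname{Im}z\}$. Let $f:\mathbb H\to\mathbb H$ be a hyperbolic holomorphic self-map with Denjoy–Wolff point $\infty$; that is, $f$ has no fixed point in $\mathbb H$, its iterates $f^n$ converge to $\infty$ locally uniformly on $\mathbb H$, and $\alpha:=f'(\infty):=\angle\lim_{z\to\infty}f(z)/z$ satisfies $\alpha\in(1,+\infty)$. Then $f$ has a unique Koenigs function $h:\mathbb H\to\mathbb H$, that is, the functions $z\mapsto f^n(z)/|f^n(i)|$ converge locally uniformly on $\mathbb H$ to a function $h$ with values in $\mathbb H$. Moreover, $f$ is of extremal rate, i.e. $\lim_{n\to+\infty}f^n(z)/\alpha^n$ exists and belongs to $\mathbb H$ for some $z\in\mathbb H$, if and only if $h$ is conformal at $\infty$, i.e. $h$ is holomorphic, $\angle\lim_{w\to\infty}h(w)=\infty$, and $\angle\lim_{w\to\infty}h(w)/w$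 exists in $\mathbb C\setminus\{0\}$. In that case, $$\lim_{n\to+\infty}\frac{f^n(z)}{\alpha^n}=h(z)\left(\angle\lim_{w\to\infty}\frac{h(w)}{w}\right)^{-1}\qquad\text{for all }z\in\mathbb H.$$ -/

import Mathlib

open Filter Topology Bornology UpperHalfPlane
open scoped Manifold

/-- The nontangential approach region (Stolz region) at `∞` of aperture `M` in the upper
half-plane: the sector `|Re z| ≤ M · Im z` around the imaginary axis. As `M` grows, these regions
exhaust all sectors `ε ≤ arg z ≤ π - ε`. -/
def sectorAtInfty (M : ℝ) : Set ℍ := {z | |z.re| ≤ M * z.im}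

/-- The angular limit `∠lim_{z → ∞} g z = l`: inside each nontangential sector, `g z` tends to `l`
as `|z| → ∞`. Take `l = 𝓝 c` for a finite limit and `l = cobounded ℂ` for the limit `∞`. -/
def AngularTendsto (g : ℍ → ℂ) (l : Filter ℂ) : Prop :=
  ∀ M : ℝ, 0 < M →
    Tendsto g (comap (fun z : ℍ => (z : ℂ)) (cobounded ℂ) ⊓ 𝓟 (sectorAtInfty M)) l

/-- `c` is the angular derivative of `g` at `∞`, i.e. `∠lim_{z → ∞} g z / z = c`. -/
def HasAngularDerivAtInfty (g : ℍ → ℂ) (c : ℂ) : Prop :=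
  AngularTendsto (fun z => g z / (z : ℂ)) (𝓝 c)

/-- `f` has no fixed point in `ℍ` and its iterates converge to `∞` locally uniformly
(i.e. uniformly on compact sets). -/
structure HasDenjoyWolffPointInfty (f : ℍ → ℍ) : Prop where
  nonelliptic : ∀ z, f z ≠ z
  iterates : ∀ K : Set ℍ, IsCompact K → ∀ R : ℝ,
    ∀ᶠ n : ℕ in atTop, ∀ z ∈ K, R ≤ ‖(f^[n] z : ℂ)‖

/-- `f` is a hyperbolic holomorphic self-map of `ℍ` with Denjoy–Wolff point `∞`
and with `f'(∞) = α > 1`. -/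
structure IsHyperbolicAtInfty (f : ℍ → ℍ) (α : ℝ) : Prop where
  holomorphic : MDifferentiable 𝓘(ℂ) 𝓘(ℂ) f
  denjoyWolff : HasDenjoyWolffPointInfty f
  angularDeriv : HasAngularDerivAtInfty (fun z => (f z : ℂ)) (α : ℂ)
  one_lt : 1 < α

/-- `h` is the (Valiron–)Koenigs function of the hyperbolic map `f`: the locally uniform limit of
the maps `z ↦ fⁿ(z) / |fⁿ(i)|`. -/
def IsKoenigsFunction (f h : ℍ → ℍ) : Prop :=
  TendstoLocallyUniformly
    (fun (n : ℕ) (z : ℍ) => (f^[n] z : ℂ) / ((‖(f^[n] UpperHalfPlane.I : ℂ)‖ : ℝ) : ℂ))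
    (fun z => (h z : ℂ)) atTop

/-- `f`, hyperbolic with `f'(∞) = α`, is of extremal rate: `lim fⁿ(z) / αⁿ` exists and lies in
`ℍ` for some `z`. -/
def IsOfExtremalRate (f : ℍ → ℍ) (α : ℝ) : Prop :=
  ∃ z L : ℍ, Tendsto (fun n : ℕ => (f^[n] z : ℂ) / (α : ℂ) ^ n) atTop (𝓝 (L : ℂ))

/-- A holomorphic `g : ℍ → ℂ` with `∠lim_{z → ∞} g z = ∞` is conformal at `∞` if
`∠lim_{z → ∞} g z / z` exists, is finite and is nonzero. -/
structure IsConformalAtInfty (g : ℍ → ℂ) : Prop where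
  holomorphic : MDifferentiable 𝓘(ℂ) 𝓘(ℂ) g
  map_infty : AngularTendsto g (cobounded ℂ)
  angularDeriv : ∃ c : ℂ, c ≠ 0 ∧ HasAngularDerivAtInfty g c

/-! Everything rests on Schwarz–Pick: holomorphic self-maps of `ℍ` contract the hyperbolic distance.
Its boundary form, Julia's lemma, gives `α * Im z ≤ Im (f z)`, so heights grow geometrically, orbits
stay in sectors, and consecutive quotients along an orbit tend to `α`. The normalized iterates are
contractions with relatively compact orbits, so they converge pointwise along every ultrafilter.
Each limit `φ` is holomorphic, solves `φ ∘ f = α φ`, has `|φ(i)| = 1`, and pulls the hyperbolic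
metric back to the same pseudo-metric `lim dist (fⁿ z) (fⁿ w)`. These properties determine `φ`
(`im_eq_of_dist_eq`, `eq_of_im_eq`), so all ultrafilter limits agree and the sequence converges. If
the rate is extremal, `fⁿ/αⁿ → r h` everywhere with `r > 0`, and iterated Julia gives `Im (r h(w)) ≥
Im w`. Thus `r h - id + i` maps `ℍ` to itself; it is `o(|z|)` along an orbit, hence in every sector,
so `h(w)/w → 1/r`. Conversely, evaluating `h(w)/w` along an orbit, where `h(fⁿ z) = αⁿ h(z)`, gives
the rate. -/

open scoped ComplexConjugate

/-! ### Schwarz–Pick and its consequences. -/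

namespace UpperHalfPlane

lemma im_le_norm (z : ℍ) : z.im ≤ ‖(z : ℂ)‖ := Complex.im_le_norm z

lemma norm_pos (z : ℍ) : 0 < ‖(z : ℂ)‖ := norm_pos_iff.mpr z.ne_zero

lemma norm_sub_lt_norm_sub_conj (z w : ℍ) : ‖(z : ℂ) - w‖ < ‖(z : ℂ) - conj (w : ℂ)‖ := by
  rw [← sq_lt_sq₀ (norm_nonneg _) (norm_nonneg _), Complex.sq_norm, Complex.sq_norm,
    Complex.normSq_apply, Complex.normSq_apply]
  simp only [Complex.sub_re, Complex.sub_im, Complex.conj_re, Complex.conj_im, coe_re, coe_im]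
  nlinarith [mul_pos z.im_pos w.im_pos]

lemma sub_conj_ne_zero (z w : ℍ) : (z : ℂ) - conj (w : ℂ) ≠ 0 :=
  norm_pos_iff.mp ((norm_nonneg _).trans_lt (norm_sub_lt_norm_sub_conj z w))

/-- The expression is the inverse of the Cayley transform `z ↦ (z - w) / (z - conj w)`, which
carries `ℍ` onto the unit disc and `w` to `0`. -/
lemma im_cayley_symm_pos (w : ℍ) {ζ : ℂ} (hζ : ‖ζ‖ < 1) :
    0 < (((w : ℂ) - conj (w : ℂ) * ζ) / (1 - ζ)).im := by
  have h1 : (1 - ζ) ≠ 0 := by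
    intro h
    rw [← sub_eq_zero.mp h] at hζ
    simp at hζ
  have h2 : 0 < Complex.normSq (1 - ζ) := Complex.normSq_pos.mpr h1
  have h3 : Complex.normSq ζ < 1 := by
    rw [Complex.normSq_eq_norm_sq]
    nlinarith [norm_nonneg ζ]
  have : (((w : ℂ) - conj (w : ℂ) * ζ) / (1 - ζ)).im
      = w.im * (1 - Complex.normSq ζ) / Complex.normSq (1 - ζ) := by
    rw [Complex.div_im]
    simp only [Complex.sub_re, Complex.sub_im, Complex.mul_re, Complex.mul_im, Complex.conj_re,
      Complex.conj_im, Complex.one_re, Complex.one_im, coe_re, coe_im, Complex.normSq_apply ζ]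
    field_simp
    ring
  rw [this]
  exact div_pos (mul_pos w.im_pos (by linarith)) h2

/-- The **Schwarz–Pick lemma** in quotient form. -/
lemma norm_div_le_of_mdifferentiable {F : ℍ → ℍ}
    (hF : MDifferentiable 𝓘(ℂ) 𝓘(ℂ) (fun z => (F z : ℂ))) (z w : ℍ) :
    ‖((F z : ℂ) - F w) / (F z - conj (F w : ℂ))‖ ≤ ‖((z : ℂ) - w) / (z - conj (w : ℂ))‖ := by
  rw [mdifferentiable_iff] at hF
  set G : ℂ → ℂ := (fun z => (F z : ℂ)) ∘ ofComplex with hG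
  set C : ℂ → ℂ := fun ζ => ((w : ℂ) - conj (w : ℂ) * ζ) / (1 - ζ) with hC
  have hCd : DifferentiableOn ℂ C (Metric.ball 0 1) := by
    refine DifferentiableOn.div (by fun_prop) (by fun_prop) ?_
    intro ζ hζ h
    rw [← sub_eq_zero.mp h] at hζ
    simp at hζ
  have hCm : Set.MapsTo C (Metric.ball 0 1) {z | 0 < z.im} := fun ζ hζ =>
    im_cayley_symm_pos w (by simpa using hζ)
  have hGC : DifferentiableOn ℂ (G ∘ C) (Metric.ball 0 1) := hF.comp hCd hCm
  -- `F` read through the Cayley transforms centred at `w` and `F w`: a map of the disc fixing `0`,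
  -- to which the classical Schwarz lemma applies.
  set g : ℂ → ℂ := fun ζ => ((G ∘ C) ζ - F w) / ((G ∘ C) ζ - conj (F w : ℂ)) with hg
  have hgd : DifferentiableOn ℂ g (Metric.ball 0 1) := by
    refine DifferentiableOn.div (hGC.sub_const _) (hGC.sub_const _) ?_
    intro ζ _
    exact sub_conj_ne_zero _ _
  have hgm : Set.MapsTo g (Metric.ball 0 1) (Metric.closedBall 0 1) := by
    intro ζ _
    rw [mem_closedBall_zero_iff, hg, norm_div]
    exact div_le_one_of_le₀ (norm_sub_lt_norm_sub_conj _ _).le (norm_nonneg _)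
  have hC0 : C 0 = w := by simp [hC]
  have hg0 : g 0 = 0 := by simp [hg, hC0, hG]
  set ζ : ℂ := ((z : ℂ) - w) / (z - conj (w : ℂ)) with hζ
  have hζ1 : ‖ζ‖ < 1 := by
    rw [hζ, norm_div, div_lt_one (norm_pos_iff.mpr (sub_conj_ne_zero z w))]
    exact norm_sub_lt_norm_sub_conj z w
  have hCζ : C ζ = z := by
    have h1 := sub_conj_ne_zero z w
    have h2 := sub_conj_ne_zero w w
    have h3 : 1 - ζ = ((w : ℂ) - conj (w : ℂ)) / (z - conj (w : ℂ)) := by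
      rw [hζ]
      field_simp
      ring
    simp only [hC]
    rw [h3, hζ]
    field_simp
    ring
  have := Complex.norm_le_norm_of_mapsTo_ball hgd hgm hg0 hζ1
  simpa [hg, hCζ, hG] using this

/-- The **Schwarz–Pick lemma**: holomorphic self-maps of `ℍ` do not increase the hyperbolic
distance. -/
theorem dist_map_le_of_mdifferentiable {F : ℍ → ℍ}
    (hF : MDifferentiable 𝓘(ℂ) 𝓘(ℂ) (fun z => (F z : ℂ))) (z w : ℍ) :
    dist (F z) (F w) ≤ dist z w := by
  have h := norm_div_le_of_mdifferentiable hF z w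
  rw [norm_div, norm_div, ← dist_eq_norm, ← dist_eq_norm, ← dist_eq_norm, ← dist_eq_norm,
    ← tanh_half_dist, ← tanh_half_dist] at h
  have h' := Real.artanh_le_artanh (Real.neg_one_lt_tanh _) (Real.tanh_lt_one _) h
  rw [Real.artanh_tanh, Real.artanh_tanh] at h'
  linarith

/-- The left side is an increasing function of the hyperbolic distance, so comparisons of distances
become polynomial relations in real and imaginary parts. -/
lemma sq_dist_div_eq (z w : ℍ) :
    dist (z : ℂ) w ^ 2 / (z.im * w.im) = 2 * (Real.cosh (dist z w) - 1) := by
  rw [cosh_dist]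
  have := z.im_ne_zero
  have := w.im_ne_zero
  field_simp
  ring

lemma sq_dist_mul_le_of_dist_le {a b z w : ℍ} (h : dist a b ≤ dist z w) :
    dist (a : ℂ) b ^ 2 * (z.im * w.im) ≤ dist (z : ℂ) w ^ 2 * (a.im * b.im) := by
  rw [← div_le_div_iff₀ (mul_pos a.im_pos b.im_pos) (mul_pos z.im_pos w.im_pos),
    sq_dist_div_eq, sq_dist_div_eq]
  have := Real.cosh_le_cosh.mpr (by rwa [abs_of_nonneg dist_nonneg, abs_of_nonneg dist_nonneg] :
    |dist a b| ≤ |dist z w|)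
  linarith

lemma sq_dist_mul_eq_of_dist_eq {a b z w : ℍ} (h : dist a b = dist z w) :
    dist (a : ℂ) b ^ 2 * (z.im * w.im) = dist (z : ℂ) w ^ 2 * (a.im * b.im) :=
  (sq_dist_mul_le_of_dist_le h.le).antisymm (sq_dist_mul_le_of_dist_le h.ge)

/-- A holomorphic function on `ℍ` with real values is constant. -/
lemma eq_of_mdifferentiable_of_im_eq_zero {g : ℍ → ℂ} (hg : MDifferentiable 𝓘(ℂ) 𝓘(ℂ) g)
    (him : ∀ z, (g z).im = 0) (z w : ℍ) : g z = g w := by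
  -- Schwarz–Pick for `t g + i`, which has constant height `1`, for arbitrarily large `t`.
  have key : ∀ t : ℝ, t ^ 2 * (dist (g z) (g w) ^ 2 * (z.im * w.im)) ≤ dist (z : ℂ) w ^ 2 := by
    intro t
    let P : ℍ → ℍ := fun z => ⟨(t : ℂ) * g z + Complex.I, by simp [him]⟩
    have hP : MDifferentiable 𝓘(ℂ) 𝓘(ℂ) (fun z => (P z : ℂ)) := by
      rw [mdifferentiable_iff] at hg ⊢
      exact (hg.const_mul (t : ℂ)).add_const Complex.I
    have h := sq_dist_mul_le_of_dist_le (dist_map_le_of_mdifferentiable hP z w)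
    have h1 : ∀ z, (P z).im = 1 := fun z => by
      change ((t : ℂ) * g z + Complex.I).im = 1
      simp [him]
    have h2 : dist (P z : ℂ) (P w) = |t| * dist (g z) (g w) := by
      change dist ((t : ℂ) * g z + Complex.I) ((t : ℂ) * g w + Complex.I) = _
      rw [dist_add_right, dist_eq_norm, ← mul_sub, norm_mul, dist_eq_norm, Complex.norm_real,
        Real.norm_eq_abs]
    rw [h1, h1, h2, mul_pow, sq_abs] at h
    linarith
  by_contra hne
  have hpos : 0 < dist (g z) (g w) ^ 2 * (z.im * w.im) :=
    mul_pos (pow_pos (dist_pos.mpr hne) 2) (mul_pos z.im_pos w.im_pos)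
  set A := dist (g z) (g w) ^ 2 * (z.im * w.im)
  -- This `t` makes `t * √A` exceed `dist z w` by `√A`, contradicting `key`.
  have h := key (dist (z : ℂ) w / Real.sqrt A + 1)
  have hs : 0 < Real.sqrt A := Real.sqrt_pos.mpr hpos
  have e : (dist (z : ℂ) w / Real.sqrt A + 1) ^ 2 * A = (dist (z : ℂ) w + Real.sqrt A) ^ 2 := by
    nth_rewrite 2 [← Real.sq_sqrt hpos.le]
    rw [← mul_pow]
    congr 1
    field_simp
  rw [e] at h
  nlinarith [dist_nonneg (x := (z : ℂ)) (y := w)]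

end UpperHalfPlane

/-! ### Angular limits along sequences and Julia's lemma. -/

lemma AngularTendsto.comp_tendsto {ι : Type*} {p : Filter ι} {g : ℍ → ℂ} {l : Filter ℂ}
    (hg : AngularTendsto g l) {u : ι → ℍ} {M : ℝ} (hM : 0 < M)
    (hu : ∀ᶠ i in p, u i ∈ sectorAtInfty M) (hinf : Tendsto (fun i => ‖(u i : ℂ)‖) p atTop) :
    Tendsto (fun i => g (u i)) p l := by
  refine (hg M hM).comp ?_
  rw [tendsto_inf, tendsto_comap_iff, tendsto_principal]
  exact ⟨tendsto_norm_atTop_iff_cobounded.mp hinf, hu⟩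

/-- **Julia's lemma** at `∞`: the angular derivative bounds the dilation of imaginary parts. -/
theorem mul_im_le_im_of_hasAngularDerivAtInfty {f : ℍ → ℍ} {α : ℝ}
    (hf : MDifferentiable 𝓘(ℂ) 𝓘(ℂ) (fun z => (f z : ℂ)))
    (hα : HasAngularDerivAtInfty (fun z => (f z : ℂ)) (α : ℂ)) (hpos : 0 < α) (z : ℍ) :
    α * z.im ≤ (f z).im := by
  let u : ℕ → ℍ := fun n => ⟨((n + 1 : ℝ) : ℂ) * Complex.I, by
    simp only [Complex.im_ofReal_mul, Complex.I_im]; positivity⟩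
  have hu : ∀ n, (u n : ℂ) = ((n + 1 : ℝ) : ℂ) * Complex.I := fun n => rfl
  have hre : ∀ n, (u n).re = 0 := fun n => by rw [← coe_re, hu]; simp
  have him : ∀ n, (u n).im = n + 1 := fun n => by rw [← coe_im, hu]; simp
  have hn : Tendsto (fun n : ℕ => (n + 1 : ℝ)) atTop atTop :=
    tendsto_atTop_add_const_right _ _ tendsto_natCast_atTop_atTop
  have hlim : Tendsto (fun n => (f (u n) : ℂ) / (u n : ℂ)) atTop (𝓝 (α : ℂ)) := by
    refine AngularTendsto.comp_tendsto hα one_pos (Eventually.of_forall fun n => ?_) ?_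
    · simp only [sectorAtInfty, Set.mem_ofPred_eq, hre, abs_zero]
      exact mul_nonneg zero_le_one (u n).im_pos.le
    · refine hn.congr fun n => ?_
      rw [hu, norm_mul, Complex.norm_I, mul_one, Complex.norm_real, Real.norm_of_nonneg]
      positivity
  have hinv : Tendsto (fun n : ℕ => (((n + 1 : ℝ)⁻¹ : ℝ) : ℂ)) atTop (𝓝 0) := by
    have := (Complex.continuous_ofReal.tendsto 0).comp hn.inv_tendsto_atTop
    simpa [Function.comp_def] using this
  have hfi : Tendsto (fun n => (f (u n) : ℂ) * (((n + 1 : ℝ)⁻¹ : ℝ) : ℂ)) atTop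
      (𝓝 ((α : ℂ) * Complex.I)) := by
    refine (hlim.mul_const Complex.I).congr fun n => ?_
    have : ((n + 1 : ℝ) : ℂ) ≠ 0 := by exact_mod_cast (by positivity : (n + 1 : ℝ) ≠ 0)
    rw [hu, Complex.ofReal_inv]
    field_simp
  -- Schwarz–Pick for `z` and `u n = (n + 1) i`, divided by `(n + 1)³`; in the limit it reads `α² *
  -- Im z ≤ α * Im (f z)`.
  have hineq : ∀ n : ℕ,
      ‖(f z : ℂ) * (((n + 1 : ℝ)⁻¹ : ℝ) : ℂ) - (f (u n) : ℂ) * (((n + 1 : ℝ)⁻¹ : ℝ) : ℂ)‖ ^ 2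
        * z.im ≤ ‖(z : ℂ) * (((n + 1 : ℝ)⁻¹ : ℝ) : ℂ) - Complex.I‖ ^ 2 *
        ((f z).im * ((f (u n) : ℂ) * (((n + 1 : ℝ)⁻¹ : ℝ) : ℂ)).im) := by
    intro n
    have h := sq_dist_mul_le_of_dist_le (dist_map_le_of_mdifferentiable hf z (u n))
    have hp : (0 : ℝ) < n + 1 := by positivity
    have e1 : (z : ℂ) * (((n + 1 : ℝ)⁻¹ : ℝ) : ℂ) - Complex.I
        = ((z : ℂ) - u n) * (((n + 1 : ℝ)⁻¹ : ℝ) : ℂ) := by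
      have : ((n + 1 : ℝ) : ℂ) ≠ 0 := by exact_mod_cast hp.ne'
      rw [hu, Complex.ofReal_inv]
      field_simp
    rw [e1, ← sub_mul, norm_mul, norm_mul, ← dist_eq_norm, ← dist_eq_norm, Complex.norm_real,
      Real.norm_of_nonneg (by positivity), Complex.im_mul_ofReal, coe_im]
    rw [him] at h
    have h3 := mul_le_mul_of_nonneg_right h (by positivity : (0 : ℝ) ≤ ((n + 1 : ℝ)⁻¹) ^ 3)
    have e2 : ((n : ℝ) + 1) * ((n + 1 : ℝ)⁻¹) = 1 := mul_inv_cancel₀ hp.ne'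
    calc _ = dist (f z : ℂ) (f (u n)) ^ 2 * (z.im * ((n : ℝ) + 1)) * ((n + 1 : ℝ)⁻¹) ^ 3 := by
            linear_combination (-(dist (f z : ℂ) (f (u n)) ^ 2 * z.im * ((n + 1 : ℝ)⁻¹) ^ 2)) * e2
      _ ≤ _ := h3
      _ = _ := by ring
  have hL := ((((hinv.const_mul (f z : ℂ)).sub hfi).norm.pow 2).mul_const z.im)
  have hR := ((((hinv.const_mul (z : ℂ)).sub_const Complex.I).norm.pow 2).mul
    (((Complex.continuous_im.tendsto _).comp hfi).const_mul (f z).im))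
  have := le_of_tendsto_of_tendsto' hL hR hineq
  simp only [mul_zero, zero_sub, norm_neg, norm_mul, Complex.norm_I, Complex.norm_real,
    Real.norm_of_nonneg hpos.le, Complex.im_ofReal_mul, Complex.I_im] at this
  nlinarith

/-! ### Geometry of orbits. -/

section Orbits

variable {f : ℍ → ℍ} {α : ℝ}

lemma mem_sectorAtInfty_iff {M : ℝ} {z : ℍ} : z ∈ sectorAtInfty M ↔ |z.re| ≤ M * z.im := Iff.rfl

lemma norm_le_of_mem_sectorAtInfty {M : ℝ} {z : ℍ} (h : z ∈ sectorAtInfty M) :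
    ‖(z : ℂ)‖ ≤ (M + 1) * z.im := by
  have h1 := Complex.norm_le_abs_re_add_abs_im (z : ℂ)
  rw [coe_re, coe_im, abs_of_pos z.im_pos] at h1
  have h2 := mem_sectorAtInfty_iff.mp h
  linarith

/-- Two points of comparable modulus lying in sectors are at bounded hyperbolic distance. -/
lemma dist_le_of_mem_sectorAtInfty {M M' : ℝ} (hM : 0 < M) (hM' : 0 < M') {z w : ℍ}
    (hz : z ∈ sectorAtInfty M) (hw : w ∈ sectorAtInfty M') {K : ℝ} (hK : 0 ≤ K)
    (h1 : ‖(w : ℂ)‖ ≤ ‖(z : ℂ)‖) (h2 : ‖(z : ℂ)‖ ≤ K * ‖(w : ℂ)‖) :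
    dist z w ≤ (K + 1) * √((M + 1) * (M' + 1)) := by
  have hs : 0 < √((M + 1) * (M' + 1)) := Real.sqrt_pos.mpr (by positivity)
  refine (dist_le_dist_coe_div_sqrt z w).trans ?_
  rw [div_le_iff₀ (Real.sqrt_pos.mpr (mul_pos z.im_pos w.im_pos)), mul_assoc,
    ← Real.sqrt_mul (by positivity)]
  have h3 : dist (z : ℂ) w ≤ (K + 1) * ‖(w : ℂ)‖ := by
    rw [dist_eq_norm]
    linarith [norm_sub_le (z : ℂ) w]
  refine h3.trans (mul_le_mul_of_nonneg_left ?_ (by positivity))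
  refine Real.le_sqrt_of_sq_le ?_
  have hz' := norm_le_of_mem_sectorAtInfty hz
  have hw' := norm_le_of_mem_sectorAtInfty hw
  calc ‖(w : ℂ)‖ ^ 2 ≤ ‖(z : ℂ)‖ * ‖(w : ℂ)‖ := by
        rw [sq]; exact mul_le_mul_of_nonneg_right h1 (norm_nonneg _)
    _ ≤ ((M + 1) * z.im) * ((M' + 1) * w.im) :=
        mul_le_mul hz' hw' (norm_nonneg _) (mul_nonneg (by positivity) z.im_pos.le)
    _ = _ := by ring

namespace IsHyperbolicAtInfty

lemma mdifferentiable_coe (hf : IsHyperbolicAtInfty f α) :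
    MDifferentiable 𝓘(ℂ) 𝓘(ℂ) (fun z => (f z : ℂ)) :=
  UpperHalfPlane.mdifferentiable_coe.comp hf.holomorphic

lemma pos (hf : IsHyperbolicAtInfty f α) : 0 < α := one_pos.trans hf.one_lt

lemma mul_im_le (hf : IsHyperbolicAtInfty f α) (z : ℍ) : α * z.im ≤ (f z).im :=
  mul_im_le_im_of_hasAngularDerivAtInfty hf.mdifferentiable_coe hf.angularDeriv hf.pos z

lemma pow_mul_im_le (hf : IsHyperbolicAtInfty f α) (z : ℍ) (n : ℕ) :
    α ^ n * z.im ≤ (f^[n] z).im := by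
  induction n with
  | zero => simp
  | succ n ih =>
    rw [Function.iterate_succ_apply', pow_succ']
    calc _ = α * (α ^ n * z.im) := by ring
      _ ≤ α * (f^[n] z).im := mul_le_mul_of_nonneg_left ih hf.pos.le
      _ ≤ _ := hf.mul_im_le _

lemma lipschitzWith_iterate (hf : IsHyperbolicAtInfty f α) (n : ℕ) : LipschitzWith 1 f^[n] := by
  have : LipschitzWith 1 f := LipschitzWith.of_dist_le_mul fun z w => by
    simpa using dist_map_le_of_mdifferentiable hf.mdifferentiable_coe z w
  simpa using this.iterate n

lemma dist_iterate_le (hf : IsHyperbolicAtInfty f α) (n : ℕ) (z w : ℍ) :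
    dist (f^[n] z) (f^[n] w) ≤ dist z w := by
  simpa using (hf.lipschitzWith_iterate n).dist_le_mul z w

lemma mdifferentiable_iterate (hf : IsHyperbolicAtInfty f α) (n : ℕ) :
    MDifferentiable 𝓘(ℂ) 𝓘(ℂ) f^[n] := by
  induction n with
  | zero => exact mdifferentiable_id
  | succ n ih => exact ih.comp hf.holomorphic

lemma tendsto_norm_iterate (hf : IsHyperbolicAtInfty f α) (z : ℍ) :
    Tendsto (fun n => ‖(f^[n] z : ℂ)‖) atTop atTop := by
  refine tendsto_atTop_mono (fun n => (hf.pow_mul_im_le z n).trans (im_le_norm _)) ?_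
  exact (tendsto_pow_atTop_atTop_of_one_lt hf.one_lt).atTop_mul_const z.im_pos

/-- The hyperbolic step does not grow along the orbit, so the Euclidean step is at most a fixed
multiple of the current height. -/
lemma dist_coe_iterate_succ_le (hf : IsHyperbolicAtInfty f α) (z : ℍ) (n : ℕ) :
    dist (f^[n + 1] z : ℂ) (f^[n] z) ≤ (f^[n] z).im * (Real.exp (dist (f z) z) - 1) := by
  refine (dist_coe_le _ _).trans (mul_le_mul_of_nonneg_left ?_ (im_pos _).le)
  gcongr
  rw [Function.iterate_succ_apply]
  exact hf.dist_iterate_le n _ _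

/-- Orbits of a hyperbolic map stay in a sector. -/
lemma exists_forall_iterate_mem_sectorAtInfty (hf : IsHyperbolicAtInfty f α) (z : ℍ) :
    ∃ M : ℝ, 0 < M ∧ ∀ n, f^[n] z ∈ sectorAtInfty M := by
  set C := Real.exp (dist (f z) z) - 1
  have hC0 : 0 ≤ C := sub_nonneg.mpr (Real.one_le_exp dist_nonneg)
  have hα : 0 < α - 1 := sub_pos.mpr hf.one_lt
  -- The first term handles `n = 0`. The second handles the induction: a step adds at most `C * Im`
  -- to `|Re|` and at least `(α - 1) * Im` to the height. The `1` ensures positivity.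
  set M := |z.re| / z.im + C / (α - 1) + 1
  have hz := z.im_pos
  have hM : 0 < M := by positivity
  refine ⟨M, hM, fun n => ?_⟩
  induction n with
  | zero =>
    rw [Function.iterate_zero_apply, mem_sectorAtInfty_iff, ← div_le_iff₀ hz]
    have : 0 ≤ C / (α - 1) := by positivity
    linarith
  | succ n ih =>
    rw [mem_sectorAtInfty_iff] at ih ⊢
    have h1 := (Complex.abs_re_le_norm ((f^[n + 1] z : ℂ) - f^[n] z)).trans_eq
      (dist_eq_norm _ _).symm
    have h2 := h1.trans (hf.dist_coe_iterate_succ_le z n)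
    rw [Complex.sub_re, coe_re, coe_re] at h2
    have h3 : α * (f^[n] z).im ≤ (f^[n + 1] z).im := by
      rw [Function.iterate_succ_apply']; exact hf.mul_im_le _
    have h4 : C ≤ M * (α - 1) := by
      have h5 : C / (α - 1) ≤ M := by
        have : 0 ≤ |z.re| / z.im := by positivity
        linarith
      rwa [div_le_iff₀ hα] at h5
    have h6 := abs_sub_abs_le_abs_sub (f^[n + 1] z).re (f^[n] z).re
    have h7 := mul_le_mul_of_nonneg_left h3 hM.le
    have h8 := mul_le_mul_of_nonneg_left h4 (f^[n] z).im_pos.le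
    nlinarith

/-- Along orbits, the consecutive quotients tend to the angular derivative. -/
lemma tendsto_iterate_succ_div (hf : IsHyperbolicAtInfty f α) (z : ℍ) :
    Tendsto (fun n => (f^[n + 1] z : ℂ) / (f^[n] z : ℂ)) atTop (𝓝 (α : ℂ)) := by
  obtain ⟨M, hM, hs⟩ := hf.exists_forall_iterate_mem_sectorAtInfty z
  simp only [Function.iterate_succ_apply']
  exact AngularTendsto.comp_tendsto hf.angularDeriv hM (Eventually.of_forall hs)
    (hf.tendsto_norm_iterate z)

end IsHyperbolicAtInfty

/-! ### Normalized iterates and their limits along filters. -/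

/-- The normalized iterate `z ↦ fⁿ(z) / |fⁿ(i)|` as a self-map of `ℍ`. -/
noncomputable def normalizedIterate (f : ℍ → ℍ) (n : ℕ) (z : ℍ) : ℍ :=
  (⟨‖(f^[n] UpperHalfPlane.I : ℂ)‖⁻¹, inv_pos.mpr (UpperHalfPlane.norm_pos _)⟩ :
    {x : ℝ // 0 < x}) • f^[n] z

lemma coe_normalizedIterate (f : ℍ → ℍ) (n : ℕ) (z : ℍ) :
    (normalizedIterate f n z : ℂ)
      = (f^[n] z : ℂ) / ((‖(f^[n] UpperHalfPlane.I : ℂ)‖ : ℝ) : ℂ) := by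
  rw [normalizedIterate, coe_pos_real_smul, Complex.real_smul, Complex.ofReal_inv, div_eq_inv_mul]

lemma dist_normalizedIterate (f : ℍ → ℍ) (n : ℕ) (z w : ℍ) :
    dist (normalizedIterate f n z) (normalizedIterate f n w) = dist (f^[n] z) (f^[n] w) :=
  (isometry_pos_mul _).dist_eq _ _

lemma norm_normalizedIterate_I (f : ℍ → ℍ) (n : ℕ) :
    ‖(normalizedIterate f n UpperHalfPlane.I : ℂ)‖ = 1 := by
  rw [coe_normalizedIterate, norm_div, Complex.norm_real, norm_norm,
    div_self (UpperHalfPlane.norm_pos _).ne']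

lemma mem_sectorAtInfty_pos_smul {M : ℝ} {z : ℍ} (x : {x : ℝ // 0 < x}) :
    x • z ∈ sectorAtInfty M ↔ z ∈ sectorAtInfty M := by
  rw [mem_sectorAtInfty_iff, mem_sectorAtInfty_iff, pos_real_re, pos_real_im, abs_mul,
    abs_of_pos x.2, mul_left_comm, mul_le_mul_iff_right₀ x.2]

/-- Pointwise convergent families of hyperbolic contractions converge locally uniformly. -/
lemma UpperHalfPlane.tendstoLocallyUniformly_of_dist_le {ι : Type*} {p : Filter ι} [p.NeBot]
    {F : ι → ℍ → ℍ} {g : ℍ → ℍ} (hF : ∀ i z w, dist (F i z) (F i w) ≤ dist z w)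
    (hg : ∀ z, Tendsto (fun i => F i z) p (𝓝 (g z))) :
    TendstoLocallyUniformly (fun i z => (F i z : ℂ)) (fun z => (g z : ℂ)) p := by
  have hgd : ∀ z w, dist (g z) (g w) ≤ dist z w := fun z w =>
    le_of_tendsto ((hg z).dist (hg w)) (Eventually.of_forall fun i => hF i z w)
  rw [tendstoLocallyUniformly_iff_forall_tendsto]
  intro x
  have hx : Tendsto (fun y : ι × ℍ => dist y.2 x) (p ×ˢ 𝓝 x) (𝓝 0) :=
    tendsto_iff_dist_tendsto_zero.mp tendsto_snd
  have h1 : Tendsto (fun y : ι × ℍ => g y.2) (p ×ˢ 𝓝 x) (𝓝 (g x)) := by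
    rw [tendsto_iff_dist_tendsto_zero]
    exact squeeze_zero (fun _ => dist_nonneg) (fun y => hgd _ _) hx
  have h2 : Tendsto (fun y : ι × ℍ => F y.1 y.2) (p ×ˢ 𝓝 x) (𝓝 (g x)) := by
    rw [tendsto_iff_dist_tendsto_zero]
    refine squeeze_zero (fun _ => dist_nonneg)
      (fun y => (dist_triangle _ (F y.1 x) _).trans (add_le_add_left (hF _ _ _) _)) ?_
    have h3 : Tendsto (fun y : ι × ℍ => dist (F y.1 x) (g x)) (p ×ˢ 𝓝 x) (𝓝 0) :=
      tendsto_iff_dist_tendsto_zero.mp ((hg x).comp tendsto_fst)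
    simpa using hx.add h3
  refine Tendsto.mono_right ?_ (nhds_le_uniformity (g x : ℂ))
  rw [nhds_prod_eq]
  exact ((continuous_coe.tendsto _).comp h1).prodMk ((continuous_coe.tendsto _).comp h2)

lemma UpperHalfPlane.mdifferentiable_of_tendstoLocallyUniformly {ι : Type*} {p : Filter ι}
    [p.NeBot] {F : ι → ℍ → ℂ} {g : ℍ → ℂ} (hF : ∀ i, MDifferentiable 𝓘(ℂ) 𝓘(ℂ) (F i))
    (h : TendstoLocallyUniformly F g p) : MDifferentiable 𝓘(ℂ) 𝓘(ℂ) g := by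
  simp only [mdifferentiable_iff] at hF ⊢
  refine TendstoLocallyUniformlyOn.differentiableOn (F := fun i => F i ∘ ofComplex) (φ := p) ?_
    (Eventually.of_forall hF) isOpen_upperHalfPlaneSet
  refine (tendstoLocallyUniformlyOn_univ.mpr h).comp ofComplex (Set.mapsTo_univ _ _) ?_
  intro z hz
  exact (mdifferentiableAt_ofComplex hz).continuousAt.continuousWithinAt

namespace IsHyperbolicAtInfty

lemma mdifferentiable_normalizedIterate (hf : IsHyperbolicAtInfty f α) (n : ℕ) :
    MDifferentiable 𝓘(ℂ) 𝓘(ℂ) (fun z => (normalizedIterate f n z : ℂ)) := by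
  have := UpperHalfPlane.mdifferentiable_coe.comp (hf.mdifferentiable_iterate n)
  rw [mdifferentiable_iff] at this ⊢
  simp only [coe_normalizedIterate]
  exact this.div_const _

lemma dist_normalizedIterate_le (hf : IsHyperbolicAtInfty f α) (n : ℕ) (z w : ℍ) :
    dist (normalizedIterate f n z) (normalizedIterate f n w) ≤ dist z w :=
  (dist_normalizedIterate f n z w).trans_le (hf.dist_iterate_le n z w)

/-- The images of `i` have modulus `1` and lie in one sector, so they stay near `i`; contraction
carries the bound to every `z`. -/
lemma exists_forall_dist_normalizedIterate_le (hf : IsHyperbolicAtInfty f α) (z : ℍ) :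
    ∃ R, ∀ n, normalizedIterate f n z ∈ Metric.closedBall UpperHalfPlane.I R := by
  obtain ⟨M, hM, hs⟩ := hf.exists_forall_iterate_mem_sectorAtInfty UpperHalfPlane.I
  refine ⟨dist z UpperHalfPlane.I + (1 + 1) * √((1 + 1) * (M + 1)), fun n => ?_⟩
  have h1 : dist UpperHalfPlane.I (normalizedIterate f n UpperHalfPlane.I)
      ≤ (1 + 1) * √((1 + 1) * (M + 1)) := by
    have hmem : normalizedIterate f n UpperHalfPlane.I ∈ sectorAtInfty M :=
      (mem_sectorAtInfty_pos_smul _).mpr (hs n)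
    refine dist_le_of_mem_sectorAtInfty one_pos hM ?_ hmem zero_le_one ?_ ?_
    · simp [mem_sectorAtInfty_iff]
    · rw [norm_normalizedIterate_I]; simp
    · rw [norm_normalizedIterate_I]; simp
  rw [Metric.mem_closedBall]
  refine (dist_triangle _ (normalizedIterate f n UpperHalfPlane.I) _).trans ?_
  rw [dist_comm _ UpperHalfPlane.I]
  exact add_le_add (hf.dist_normalizedIterate_le n _ _) h1

lemma exists_tendsto_ultrafilter (hf : IsHyperbolicAtInfty f α) (U : Ultrafilter ℕ) :
    ∃ φ : ℍ → ℍ, ∀ z, Tendsto (fun n => normalizedIterate f n z) U (𝓝 (φ z)) := by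
  have : ∀ z, ∃ a, Tendsto (fun n => normalizedIterate f n z) U (𝓝 a) := by
    intro z
    obtain ⟨R, hR⟩ := hf.exists_forall_dist_normalizedIterate_le z
    obtain ⟨a, -, ha⟩ := (isCompact_closedBall UpperHalfPlane.I R).ultrafilter_le_nhds
      (U.map fun n => normalizedIterate f n z) (by
        rw [le_principal_iff]
        exact Filter.mem_map.mpr (Filter.univ_mem' hR))
    exact ⟨a, ha⟩
  choose φ hφ using this
  exact ⟨φ, hφ⟩

section Limits

variable {p q : Filter ℕ} [p.NeBot] [q.NeBot] {φ ψ : ℍ → ℍ}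

lemma tendstoLocallyUniformly_of_tendsto (hf : IsHyperbolicAtInfty f α)
    (hφ : ∀ z, Tendsto (fun n => normalizedIterate f n z) p (𝓝 (φ z))) :
    TendstoLocallyUniformly (fun n z => (normalizedIterate f n z : ℂ)) (fun z => (φ z : ℂ)) p :=
  UpperHalfPlane.tendstoLocallyUniformly_of_dist_le hf.dist_normalizedIterate_le hφ

lemma mdifferentiable_of_tendsto (hf : IsHyperbolicAtInfty f α)
    (hφ : ∀ z, Tendsto (fun n => normalizedIterate f n z) p (𝓝 (φ z))) :
    MDifferentiable 𝓘(ℂ) 𝓘(ℂ) (fun z => (φ z : ℂ)) :=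
  UpperHalfPlane.mdifferentiable_of_tendstoLocallyUniformly hf.mdifferentiable_normalizedIterate
    (hf.tendstoLocallyUniformly_of_tendsto hφ)

lemma norm_limit_I (hφ : ∀ z, Tendsto (fun n => normalizedIterate f n z) p (𝓝 (φ z))) :
    ‖(φ UpperHalfPlane.I : ℂ)‖ = 1 := by
  have := ((continuous_coe.tendsto _).comp (hφ UpperHalfPlane.I)).norm
  simp only [Function.comp_def, norm_normalizedIterate_I] at this
  exact tendsto_nhds_unique this tendsto_const_nhds

/-- Both sides carry the same normalizing factor, so only the quotient of consecutive iterates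
matters, and it tends to `α`. -/
lemma limit_map (hf : IsHyperbolicAtInfty f α) (hp : p ≤ atTop)
    (hφ : ∀ z, Tendsto (fun n => normalizedIterate f n z) p (𝓝 (φ z))) (z : ℍ) :
    (φ (f z) : ℂ) = α * φ z := by
  have h1 := (continuous_coe.tendsto _).comp (hφ (f z))
  have h2 := ((hf.tendsto_iterate_succ_div z).mono_left hp).mul
    ((continuous_coe.tendsto _).comp (hφ z))
  refine tendsto_nhds_unique h1 (h2.congr fun n => ?_)
  simp only [Function.comp_def, coe_normalizedIterate, Function.iterate_succ_apply]
  have := (f^[n] z).ne_zero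
  field_simp

/-- Normalization is a hyperbolic isometry and `dist (fⁿ z) (fⁿ w)` is nonincreasing, so both sides
equal its limit, whatever the filter. -/
lemma dist_limit_eq (hf : IsHyperbolicAtInfty f α) (hp : p ≤ atTop) (hq : q ≤ atTop)
    (hφ : ∀ z, Tendsto (fun n => normalizedIterate f n z) p (𝓝 (φ z)))
    (hψ : ∀ z, Tendsto (fun n => normalizedIterate f n z) q (𝓝 (ψ z))) (z w : ℍ) :
    dist (φ z) (φ w) = dist (ψ z) (ψ w) := by
  have hanti : Antitone fun n => dist (f^[n] z) (f^[n] w) := antitone_nat_of_succ_le fun n => by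
    rw [Function.iterate_succ_apply', Function.iterate_succ_apply']
    simpa using hf.dist_iterate_le 1 (f^[n] z) (f^[n] w)
  have hlim := tendsto_atTop_ciInf hanti ⟨0, by rintro _ ⟨n, rfl⟩; exact dist_nonneg⟩
  have h1 := (hφ z).dist (hφ w)
  have h2 := (hψ z).dist (hψ w)
  simp only [dist_normalizedIterate] at h1 h2
  exact (tendsto_nhds_unique h1 (hlim.mono_left hp)).trans
    (tendsto_nhds_unique (hlim.mono_left hq) h2)

end Limits

end IsHyperbolicAtInfty

/-! ### Uniqueness of the limit and Valiron's theorem. -/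

/-- Two solutions of Schröder's equation inducing the same pseudo-metric have the same imaginary
part. -/
lemma im_eq_of_dist_eq {φ ψ : ℍ → ℍ} (hα : 1 < α) (hφ : ∀ z, (φ (f z) : ℂ) = α * φ z)
    (hψ : ∀ z, (ψ (f z) : ℂ) = α * ψ z) (hd : ∀ z w, dist (φ z) (φ w) = dist (ψ z) (ψ w))
    {w : ℍ} (hw : ‖(φ w : ℂ)‖ = ‖(ψ w : ℂ)‖) (z : ℍ) : (φ z).im = (ψ z).im := by
  have him : ∀ {φ : ℍ → ℍ}, (∀ z, (φ (f z) : ℂ) = α * φ z) → ∀ z, (φ (f z)).im = α * (φ z).im :=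
    fun h z => by rw [← coe_im, h, Complex.im_ofReal_mul, coe_im]
  have hre : ∀ {φ : ℍ → ℍ}, (∀ z, (φ (f z) : ℂ) = α * φ z) → ∀ z, (φ (f z)).re = α * (φ z).re :=
    fun h z => by rw [← coe_re, h, Complex.re_ofReal_mul, coe_re]
  have hsq : ∀ a b : ℍ, dist (a : ℂ) b ^ 2 = (a.re - b.re) ^ 2 + (a.im - b.im) ^ 2 := fun a b => by
    rw [dist_eq_norm, Complex.sq_norm, Complex.normSq_apply, Complex.sub_re, Complex.sub_im,
      coe_re, coe_re, coe_im, coe_im]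
    ring
  have hw2 : (φ w).re ^ 2 + (φ w).im ^ 2 = (ψ w).re ^ 2 + (ψ w).im ^ 2 := by
    have := congrArg (· ^ 2) hw
    simp only [Complex.sq_norm, Complex.normSq_apply, coe_re, coe_im] at this
    linarith
  have hα0 : 0 < α := by linarith
  have hα1 : 0 < α - 1 := by linarith
  have hB := (φ w).im_pos
  have hB' := (ψ w).im_pos
  have hN : 0 < (φ w).re ^ 2 + (φ w).im ^ 2 := by positivity
  have hwim : (φ w).im = (ψ w).im := by
    -- The distance between a point and its `α`-multiple depends only on the ratio of height to
    -- modulus.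
    have h := sq_dist_mul_eq_of_dist_eq (hd (f w) w)
    rw [hsq, hsq, him hφ, him hψ, hre hφ, hre hψ] at h
    have h1 : ((α - 1) ^ 2 * α * ((φ w).re ^ 2 + (φ w).im ^ 2)) *
        ((ψ w).im ^ 2 - (φ w).im ^ 2) = 0 := by
      linear_combination h - (α - 1) ^ 2 * α * (φ w).im ^ 2 * hw2
    rcases mul_eq_zero.mp h1 with h2 | h2
    · exact absurd h2 (by positivity)
    · nlinarith
  have h0 := sq_dist_mul_eq_of_dist_eq (hd z w)
  have h1 := sq_dist_mul_eq_of_dist_eq (hd z (f w))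
  have h2 := sq_dist_mul_eq_of_dist_eq (hd z (f (f w)))
  rw [hsq, hsq] at h0 h1 h2
  simp only [him hφ, him hψ, hre hφ, hre hψ] at h0 h1 h2
  rw [← hwim] at h0 h1 h2 hw2
  have hX : (φ w).re ^ 2 = (ψ w).re ^ 2 := by linarith
  set b := (φ w).re
  set b' := (ψ w).re
  set m := (φ w).im
  set x := (φ z).re
  set x' := (ψ z).re
  set y := (φ z).im
  set y' := (ψ z).im
  have e0 : ((x - b) ^ 2 + (y - m) ^ 2) * y' = ((x' - b') ^ 2 + (y' - m) ^ 2) * y :=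
    mul_right_cancel₀ hB.ne' (by linarith)
  have e1 : ((x - α * b) ^ 2 + (y - α * m) ^ 2) * y'
      = ((x' - α * b') ^ 2 + (y' - α * m) ^ 2) * y :=
    mul_right_cancel₀ (by positivity : α * m ≠ 0) (by linarith)
  have e2 : ((x - α * (α * b)) ^ 2 + (y - α * (α * m)) ^ 2) * y'
      = ((x' - α * (α * b')) ^ 2 + (y' - α * (α * m)) ^ 2) * y :=
    mul_right_cancel₀ (by positivity : α * (α * m) ≠ 0) (by linarith)
  -- `e0`, `e1`, `e2` equate two quadratics in `t` at `t = 1, α, α²`. This combination kills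
  -- constant and linear terms, leaving the leading coefficients `(b² + m²) * y'` and `(b² + m²) *
  -- y`.
  have h3 : (α * (α - 1) * (α ^ 2 - 1) * (b ^ 2 + m ^ 2)) * (y' - y) = 0 := by
    linear_combination e2 - e1 - α * (e1 - e0) - α * (α - 1) * (α ^ 2 - 1) * y * hX
  have hα2 : 0 < α ^ 2 - 1 := by nlinarith
  rcases mul_eq_zero.mp h3 with h4 | h4
  · exact absurd h4 (by positivity)
  · linarith

/-- Two holomorphic solutions of Schröder's equation with the same imaginary part agree. -/
lemma eq_of_im_eq {φ ψ : ℍ → ℍ} (hα : 1 < α) (hφ : ∀ z, (φ (f z) : ℂ) = α * φ z)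
    (hψ : ∀ z, (ψ (f z) : ℂ) = α * ψ z)
    (hφd : MDifferentiable 𝓘(ℂ) 𝓘(ℂ) (fun z => (φ z : ℂ)))
    (hψd : MDifferentiable 𝓘(ℂ) 𝓘(ℂ) (fun z => (ψ z : ℂ)))
    (him : ∀ z, (φ z).im = (ψ z).im) : φ = ψ := by
  funext z
  have hd : MDifferentiable 𝓘(ℂ) 𝓘(ℂ) (fun z => (φ z : ℂ) - ψ z) := by
    rw [mdifferentiable_iff] at hφd hψd ⊢
    exact hφd.sub hψd
  -- The difference is real-valued, hence constant, yet `f` multiplies it by `α ≠ 1`.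
  have h := eq_of_mdifferentiable_of_im_eq_zero hd (fun z => by simp [him z]) (f z) z
  simp only [hφ, hψ] at h
  have h1 : ((α : ℂ) - 1) * ((φ z : ℂ) - ψ z) = 0 := by linear_combination h
  rcases mul_eq_zero.mp h1 with h2 | h2
  · exact absurd (by exact_mod_cast sub_eq_zero.mp h2) hα.ne'
  · exact UpperHalfPlane.coe_injective (sub_eq_zero.mp h2)

namespace IsHyperbolicAtInfty

/-- **Valiron's theorem**, pointwise form: the normalized iterates converge. -/
theorem exists_tendsto_normalizedIterate (hf : IsHyperbolicAtInfty f α) :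
    ∃ h : ℍ → ℍ, ∀ z, Tendsto (fun n => normalizedIterate f n z) atTop (𝓝 (h z)) := by
  obtain ⟨h, hh⟩ := hf.exists_tendsto_ultrafilter (Ultrafilter.of (atTop : Filter ℕ))
  have h0 : ((Ultrafilter.of (atTop : Filter ℕ) : Ultrafilter ℕ) : Filter ℕ) ≤ atTop := Ultrafilter.of_le atTop
  -- Convergence is tested on every ultrafilter below `atTop`, each limit being compared with the
  -- one along a fixed ultrafilter.
  refine ⟨h, fun z => tendsto_iff_ultrafilter .. |>.mpr fun U hU => ?_⟩
  obtain ⟨φ, hφ⟩ := hf.exists_tendsto_ultrafilter U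
  have : φ = h := by
    refine eq_of_im_eq hf.one_lt (hf.limit_map hU hφ) (hf.limit_map h0 hh)
      (hf.mdifferentiable_of_tendsto hφ) (hf.mdifferentiable_of_tendsto hh) ?_
    exact im_eq_of_dist_eq hf.one_lt (hf.limit_map hU hφ) (hf.limit_map h0 hh)
      (hf.dist_limit_eq hU h0 hφ hh) ((norm_limit_I hφ).trans (norm_limit_I hh).symm)
  rw [← this]
  exact hφ z

end IsHyperbolicAtInfty

lemma isKoenigsFunction_iff {h : ℍ → ℍ} : IsKoenigsFunction f h ↔
    TendstoLocallyUniformly (fun n z => (normalizedIterate f n z : ℂ)) (fun z => (h z : ℂ))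
      atTop := by
  simp only [IsKoenigsFunction, coe_normalizedIterate]

lemma IsKoenigsFunction.tendsto {h : ℍ → ℍ} (hh : IsKoenigsFunction f h) (z : ℍ) :
    Tendsto (fun n => normalizedIterate f n z) atTop (𝓝 (h z)) := by
  rw [isEmbedding_coe.tendsto_nhds_iff]
  have := (tendstoLocallyUniformlyOn_univ.mpr (isKoenigsFunction_iff.mp hh)).tendsto_at
    (Set.mem_univ z)
  exact this

theorem IsHyperbolicAtInfty.existsUnique_isKoenigsFunction (hf : IsHyperbolicAtInfty f α) :
    ∃! h : ℍ → ℍ, IsKoenigsFunction f h := by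
  obtain ⟨h, hh⟩ := hf.exists_tendsto_normalizedIterate
  refine ⟨h, isKoenigsFunction_iff.mpr (hf.tendstoLocallyUniformly_of_tendsto hh), fun g hg => ?_⟩
  funext z
  exact tendsto_nhds_unique (hg.tendsto z) (hh z)

end Orbits

/-! ### Extremal rate and conformality at infinity. -/

section ExtremalRate

variable {f : ℍ → ℍ} {α : ℝ}

/-- Finds the moment when an escaping orbit crosses the circle of radius `r`, hence an orbit point
of modulus comparable to `r`. -/
lemma exists_norm_le_and_lt_norm {u : ℕ → ℂ} (hu : Tendsto (fun n => ‖u n‖) atTop atTop) (N : ℕ)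
    {r : ℝ} (hr : ‖u N‖ ≤ r) : ∃ n, N ≤ n ∧ ‖u n‖ ≤ r ∧ r < ‖u (n + 1)‖ := by
  by_contra! hcon
  have hle : ∀ n, N ≤ n → ‖u n‖ ≤ r := fun n hn =>
    Nat.le_induction hr (fun n hn ih => hcon n hn ih) n hn
  obtain ⟨n, hn, hn'⟩ := ((hu.eventually_gt_atTop r).and (eventually_ge_atTop N)).exists
  exact absurd (hle n hn') (not_le.mpr hn)

lemma angularTendsto_iff_norm {g : ℍ → ℂ} {c : ℂ} : AngularTendsto g (𝓝 c) ↔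
    ∀ M : ℝ, 0 < M → ∀ ε : ℝ, 0 < ε → ∃ R : ℝ, ∀ z ∈ sectorAtInfty M, R ≤ ‖(z : ℂ)‖ →
      ‖g z - c‖ < ε := by
  refine forall₂_congr fun M _ => ?_
  rw [Metric.tendsto_nhds]
  refine forall₂_congr fun ε _ => ?_
  rw [← comap_norm_atTop, comap_comap, eventually_inf_principal,
    (atTop_basis.comap _).eventually_iff]
  simp only [true_and, Set.mem_preimage, Set.mem_Ici, Function.comp_apply, dist_eq_norm]
  exact exists_congr fun R => ⟨fun h z hz hR => h hR hz, fun h z hR hz => h z hz hR⟩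

lemma angularTendsto_inv_coe : AngularTendsto (fun z => (z : ℂ)⁻¹) (𝓝 0) := fun _ _ =>
  (tendsto_inv₀_cobounded.comp tendsto_comap).mono_left inf_le_left

lemma HasAngularDerivAtInfty.angularTendsto_cobounded {g : ℍ → ℂ} {c : ℂ} (hc : c ≠ 0)
    (hg : HasAngularDerivAtInfty g c) : AngularTendsto g (cobounded ℂ) := by
  intro M hM
  have h1 := hg M hM
  have h2 : Tendsto (fun z : ℍ => ‖(z : ℂ)‖)
      (comap (fun z : ℍ => (z : ℂ)) (cobounded ℂ) ⊓ 𝓟 (sectorAtInfty M)) atTop :=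
    (tendsto_norm_cobounded_atTop.comp tendsto_comap).mono_left inf_le_left
  rw [← tendsto_norm_atTop_iff_cobounded]
  refine (h1.norm.pos_mul_atTop (norm_pos_iff.mpr hc) h2).congr fun z => ?_
  rw [← norm_mul, div_mul_cancel₀ _ z.ne_zero]

namespace IsHyperbolicAtInfty

/-- If a holomorphic self-map `P` of `ℍ` satisfies `P(z)/z → 0` along one orbit of a hyperbolic
map, then `P` has angular derivative `0` at `∞`. -/
theorem hasAngularDerivAtInfty_zero_of_tendsto_orbit (hf : IsHyperbolicAtInfty f α) {P : ℍ → ℍ}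
    (hP : MDifferentiable 𝓘(ℂ) 𝓘(ℂ) (fun z => (P z : ℂ))) {z : ℍ}
    (hlim : Tendsto (fun n => (P (f^[n] z) : ℂ) / (f^[n] z : ℂ)) atTop (𝓝 0)) :
    HasAngularDerivAtInfty (fun z => (P z : ℂ)) 0 := by
  rw [HasAngularDerivAtInfty, angularTendsto_iff_norm]
  intro M hM ε hε
  obtain ⟨M', hM', hs⟩ := hf.exists_forall_iterate_mem_sectorAtInfty z
  -- `K` bounds the ratio of consecutive moduli on the orbit; `D` bounds the hyperbolic distance
  -- from a far point of the sector to the orbit. As `P` contracts, it costs at most a factor `exp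
  -- D` in `‖P‖`.
  set K := Real.exp (dist (f z) z)
  have hK0 : 0 ≤ K := (Real.exp_pos _).le
  have hK1 : 1 ≤ K := Real.one_le_exp dist_nonneg
  set D := (K + 1) * √((M + 1) * (M' + 1))
  have hsmall : ∀ᶠ n in atTop, ‖(P (f^[n] z) : ℂ) / (f^[n] z : ℂ)‖ < ε / Real.exp D := by
    simpa using Metric.tendsto_nhds.mp hlim _ (div_pos hε (Real.exp_pos D))
  obtain ⟨N, hN⟩ := eventually_atTop.mp hsmall
  refine ⟨‖(f^[N] z : ℂ)‖, fun w hw hNw => ?_⟩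
  obtain ⟨n, hn, h1, h2⟩ := exists_norm_le_and_lt_norm (hf.tendsto_norm_iterate z) N hNw
  have h3 : ‖(w : ℂ)‖ ≤ K * ‖(f^[n] z : ℂ)‖ := by
    have h4 := hf.dist_coe_iterate_succ_le z n
    rw [dist_eq_norm] at h4
    have h5 := norm_le_norm_add_norm_sub' (f^[n + 1] z : ℂ) (f^[n] z)
    have h6 := mul_le_mul_of_nonneg_right (im_le_norm (f^[n] z)) (sub_nonneg.mpr hK1)
    linarith
  have hD : dist w (f^[n] z) ≤ D := dist_le_of_mem_sectorAtInfty hM hM' hw (hs n) hK0 h1 h3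
  have hPD := (dist_map_le_of_mdifferentiable hP w (f^[n] z)).trans hD
  have h7 : ‖(P w : ℂ)‖ ≤ Real.exp D * ‖(P (f^[n] z) : ℂ)‖ := by
    have h8 := dist_coe_le (P w) (P (f^[n] z))
    rw [dist_eq_norm] at h8
    have h9 := norm_le_norm_add_norm_sub' (P w : ℂ) (P (f^[n] z))
    have h10 : (P (f^[n] z)).im * (Real.exp (dist (P w) (P (f^[n] z))) - 1)
        ≤ ‖(P (f^[n] z) : ℂ)‖ * (Real.exp D - 1) := by
      refine mul_le_mul (im_le_norm _) ?_ ?_ (norm_nonneg _)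
      · exact sub_le_sub_right (Real.exp_le_exp.mpr hPD) _
      · exact sub_nonneg.mpr (Real.one_le_exp dist_nonneg)
    linarith
  rw [sub_zero, norm_div]
  have h11 := hN n hn
  rw [norm_div, lt_div_iff₀ (Real.exp_pos _)] at h11
  refine lt_of_le_of_lt ?_ h11
  calc ‖(P w : ℂ)‖ / ‖(w : ℂ)‖ ≤ (Real.exp D * ‖(P (f^[n] z) : ℂ)‖) / ‖(f^[n] z : ℂ)‖ :=
        div_le_div₀ (by positivity) h7 (UpperHalfPlane.norm_pos _) h1
    _ = _ := by ring

variable {h : ℍ → ℍ}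

lemma limit_iterate (hf : IsHyperbolicAtInfty f α)
    (hh : ∀ z, Tendsto (fun n => normalizedIterate f n z) atTop (𝓝 (h z))) (z : ℍ) (n : ℕ) :
    (h (f^[n] z) : ℂ) = (α : ℂ) ^ n * h z := by
  induction n with
  | zero => simp
  | succ n ih =>
    rw [Function.iterate_succ_apply', hf.limit_map le_rfl hh, ih, pow_succ']
    ring

/-- One convergent orbit determines the limit of `|fⁿ(i)| / αⁿ`, and that positive number converts
normalization by `|fⁿ(i)|` into normalization by `αⁿ` for all orbits. -/
lemma tendsto_div_pow (hf : IsHyperbolicAtInfty f α)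
    (hh : ∀ z, Tendsto (fun n => normalizedIterate f n z) atTop (𝓝 (h z))) {z : ℍ} {L : ℂ}
    (hL : Tendsto (fun n : ℕ => (f^[n] z : ℂ) / (α : ℂ) ^ n) atTop (𝓝 L)) (w : ℍ) :
    Tendsto (fun n : ℕ => (f^[n] w : ℂ) / (α : ℂ) ^ n) atTop
      (𝓝 (h w * ((‖L‖ / ‖(h z : ℂ)‖ : ℝ) : ℂ))) := by
  have hz := (continuous_coe.tendsto _).comp (hh z)
  have hw := (continuous_coe.tendsto _).comp (hh w)
  have hr := hL.norm.div hz.norm (UpperHalfPlane.norm_pos _).ne'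
  refine (hw.mul ((Complex.continuous_ofReal.tendsto _).comp hr)).congr fun n => ?_
  have h1 : ‖(f^[n] z : ℂ) / (α : ℂ) ^ n‖ / ‖(normalizedIterate f n z : ℂ)‖
      = ‖(f^[n] UpperHalfPlane.I : ℂ)‖ / α ^ n := by
    rw [coe_normalizedIterate, norm_div, norm_div, norm_pow, Complex.norm_real, Complex.norm_real,
      norm_norm, Real.norm_of_nonneg hf.pos.le]
    have h2 := (UpperHalfPlane.norm_pos (f^[n] z)).ne'
    have h3 := (UpperHalfPlane.norm_pos (f^[n] UpperHalfPlane.I)).ne'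
    have h4 := hf.pos.ne'
    field_simp
  simp only [Function.comp_apply, Pi.div_apply, h1]
  have h3 : ((‖(f^[n] UpperHalfPlane.I : ℂ)‖ : ℝ) : ℂ) ≠ 0 :=
    Complex.ofReal_ne_zero.mpr (UpperHalfPlane.norm_pos _).ne'
  rw [coe_normalizedIterate, Complex.ofReal_div, Complex.ofReal_pow]
  field_simp

/-- If the Koenigs function is conformal at `∞`, the map is of extremal rate. -/
theorem isOfExtremalRate_of_hasAngularDerivAtInfty (hf : IsHyperbolicAtInfty f α)
    (hh : ∀ z, Tendsto (fun n => normalizedIterate f n z) atTop (𝓝 (h z))) {c : ℂ} (hc : c ≠ 0)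
    (hhc : HasAngularDerivAtInfty (fun z => (h z : ℂ)) c) : IsOfExtremalRate f α := by
  set z := UpperHalfPlane.I
  obtain ⟨M, hM, hs⟩ := hf.exists_forall_iterate_mem_sectorAtInfty z
  have h1 := AngularTendsto.comp_tendsto hhc hM (Eventually.of_forall hs)
    (hf.tendsto_norm_iterate z)
  have hα : (α : ℂ) ≠ 0 := Complex.ofReal_ne_zero.mpr hf.pos.ne'
  have h2 : Tendsto (fun n : ℕ => (f^[n] z : ℂ) / (α : ℂ) ^ n) atTop (𝓝 ((h z : ℂ) * c⁻¹)) := by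
    refine ((h1.inv₀ hc).const_mul (h z : ℂ)).congr fun n => ?_
    simp only [hf.limit_iterate hh]
    have := (h z).ne_zero
    have := (f^[n] z).ne_zero
    field_simp
  -- It is not yet known that `h z * c⁻¹` lies in `ℍ`; this rewrites the limit as a positive
  -- multiple of `h z`.
  have h3 := hf.tendsto_div_pow hh h2 z
  have hr : 0 < ‖(h z : ℂ) * c⁻¹‖ / ‖(h z : ℂ)‖ :=
    div_pos (norm_pos_iff.mpr (mul_ne_zero (h z).ne_zero (inv_ne_zero hc)))
      (UpperHalfPlane.norm_pos _)
  refine ⟨z, (⟨_, hr⟩ : {x : ℝ // 0 < x}) • h z, ?_⟩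
  rwa [coe_pos_real_smul, Complex.real_smul, mul_comm]

/-- If the map is of extremal rate, the Koenigs function is conformal at `∞`, with angular
derivative determined by the rate. -/
theorem exists_hasAngularDerivAtInfty_of_isOfExtremalRate (hf : IsHyperbolicAtInfty f α)
    (hh : ∀ z, Tendsto (fun n => normalizedIterate f n z) atTop (𝓝 (h z)))
    (hext : IsOfExtremalRate f α) :
    ∃ c : ℂ, c ≠ 0 ∧ HasAngularDerivAtInfty (fun z => (h z : ℂ)) c ∧
      ∀ z : ℍ, Tendsto (fun n : ℕ => (f^[n] z : ℂ) / (α : ℂ) ^ n) atTop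
        (𝓝 ((h z : ℂ) * c⁻¹)) := by
  obtain ⟨z, L, hL⟩ := hext
  have hlim := hf.tendsto_div_pow hh hL
  set r : ℝ := ‖(L : ℂ)‖ / ‖(h z : ℂ)‖
  have hr0 : 0 < r := div_pos (UpperHalfPlane.norm_pos _) (UpperHalfPlane.norm_pos _)
  have hrc : (r : ℂ) ≠ 0 := Complex.ofReal_ne_zero.mpr hr0.ne'
  have hα : (α : ℂ) ≠ 0 := Complex.ofReal_ne_zero.mpr hf.pos.ne'
  have him : ∀ w : ℍ, w.im ≤ ((h w : ℂ) * (r : ℂ)).im := by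
    intro w
    refine ge_of_tendsto ((Complex.continuous_im.tendsto _).comp (hlim w))
      (Eventually.of_forall fun n => ?_)
    have : ((f^[n] w : ℂ) / (α : ℂ) ^ n).im = (f^[n] w).im / α ^ n := by
      rw [← Complex.ofReal_pow, Complex.div_ofReal_im, coe_im]
    rw [Function.comp_apply, this, le_div_iff₀ (pow_pos hf.pos n), mul_comm]
    exact hf.pow_mul_im_le w n
  -- The inequality `him` is not strict; adding `i` puts `P` in the open half-plane without
  -- affecting its angular derivative.
  let P : ℍ → ℍ := fun w => ⟨(h w : ℂ) * (r : ℂ) - w + Complex.I, by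
    rw [Complex.add_im, Complex.sub_im, Complex.I_im, coe_im]
    linarith [him w]⟩
  have hPdef : ∀ w, (P w : ℂ) = (h w : ℂ) * (r : ℂ) - w + Complex.I := fun w => rfl
  have hP : MDifferentiable 𝓘(ℂ) 𝓘(ℂ) (fun z => (P z : ℂ)) := by
    have h1 := hf.mdifferentiable_of_tendsto hh
    have h2 := UpperHalfPlane.mdifferentiable_coe
    rw [mdifferentiable_iff] at h1 h2 ⊢
    exact ((h1.mul_const (r : ℂ)).sub h2).add_const Complex.I
  have hinv : Tendsto (fun n => (f^[n] z : ℂ)⁻¹) atTop (𝓝 0) :=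
    tendsto_inv₀_cobounded.comp (tendsto_norm_atTop_iff_cobounded.mp (hf.tendsto_norm_iterate z))
  have horb : Tendsto (fun n => (P (f^[n] z) : ℂ) / (f^[n] z : ℂ)) atTop (𝓝 0) := by
    have hne : (h z : ℂ) * (r : ℂ) ≠ 0 := mul_ne_zero (h z).ne_zero hrc
    have h1 := (((((hlim z).inv₀ hne).const_mul ((h z : ℂ) * (r : ℂ))).sub_const 1).add
      (hinv.const_mul Complex.I))
    rw [mul_inv_cancel₀ hne, sub_self, mul_zero, add_zero] at h1
    refine h1.congr fun n => ?_
    rw [hPdef, hf.limit_iterate hh]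
    have := (f^[n] z).ne_zero
    field_simp
  have hP0 := hf.hasAngularDerivAtInfty_zero_of_tendsto_orbit hP horb
  -- Solving the definition of `P` for `h` gives `h(w)/w = (P(w)/w + 1 - i/w) / r`.
  refine ⟨(r : ℂ)⁻¹, inv_ne_zero hrc, fun M hM => ?_, fun w => by rw [inv_inv]; exact hlim w⟩
  have h1 := (((hP0 M hM).add_const 1).sub
    ((angularTendsto_inv_coe M hM).const_mul Complex.I)).mul_const (r : ℂ)⁻¹
  rw [zero_add, mul_zero, sub_zero, one_mul] at h1
  refine h1.congr fun w => ?_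
  simp only [hPdef]
  have := w.ne_zero
  field_simp
  ring

end IsHyperbolicAtInfty

end ExtremalRate

theorem theorem5p2 (f : ℍ → ℍ) (α : ℝ) (hf : IsHyperbolicAtInfty f α) :
    (∃! h : ℍ → ℍ, IsKoenigsFunction f h) ∧
    ∀ h : ℍ → ℍ, IsKoenigsFunction f h →
      (IsOfExtremalRate f α ↔ IsConformalAtInfty (fun z => (h z : ℂ))) ∧
      (IsOfExtremalRate f α →
        ∃ c : ℂ, c ≠ 0 ∧ HasAngularDerivAtInfty (fun z => (h z : ℂ)) c ∧
          ∀ z : ℍ, Tendsto (fun n : ℕ => (f^[n] z : ℂ) / (α : ℂ) ^ n) atTop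
            (𝓝 ((h z : ℂ) * c⁻¹))) := by
  refine ⟨hf.existsUnique_isKoenigsFunction, fun h hh => ⟨⟨fun hext => ?_, fun hconf => ?_⟩,
    hf.exists_hasAngularDerivAtInfty_of_isOfExtremalRate hh.tendsto⟩⟩
  · obtain ⟨c, hc, hhc, -⟩ :=
      hf.exists_hasAngularDerivAtInfty_of_isOfExtremalRate hh.tendsto hext
    exact ⟨hf.mdifferentiable_of_tendsto hh.tendsto, hhc.angularTendsto_cobounded hc, c, hc, hhc⟩
  · obtain ⟨c, hc, hhc⟩ := hconf.angularDeriv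
    exact hf.isOfExtremalRate_of_hasAngularDerivAtInfty hh.tendsto hc hhc
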